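/- Let $\Gamma=(E,V,i,j)$ be a compact connected metric graph without loops or multiple edges: $E$ is finite, each edge $e\in E$ is an interval $(0,l_e)$ with $0<l_e<\infty$, initial vertex $i(e)$ and terminal vertex $j(e)$. Let $X_\Gamma$ be the space obtained by gluing the closed edges $[0,l_e]$ at the vertices. Let $(c_e)_{e\in E}$ be positive numbers, let $\mu_\Gamma$ be the measure on $X_\Gamma$ that equals $c_e$ times Lebesgue measure on each edge $e$ (vertices being null sets), and write $\|\cdot\|$ for the norm of $L^2(X_\Gamma,\mu_\Gamma)$. Let $W^{1,2}(X_\Gamma,\mu_\Gamma)$ be the space of continuous functions $f$ on $X_\Gamma$ whose restriction $f_e$ to each edge has a distributional derivative $f_e'$ in $L^2(0,l_e)$, let $df:=(c_e^{-1/2}f_e')_{e\in E}\in L^2(X_\Gamma,\mu_\Gamma)$ for $f\in W^{1,2}(X_\Gamma,\mu_\Gamma)$, and let $\mathcal{L}_\Gamma=-d^*d$ be the Kirchhoff Laplacian, i.e. the generator of the Dirichlet form $\mathcal{E}_\Gamma(f,g)=\langle df,dg\rangle_{L^2(X_\Gamma,\mu_\Gamma)}$, $f,g\in W^{1,2}(X_\Gamma,\mu_\Gamma)$.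 For $h_0\in W^{1,2}(X_\Gamma,\mu_\Gamma)$ and $u_0=dh_0$, the Cole–Hopf solution of the Burgers equation with initial condition $u_0$ is $u(t)=-2\,d\log w(t)$, $t\ge 0$, where $w(t)=e^{t\mathcal{L}_\Gamma}e^{-h_0/2}$ is the solution of the heat equation $w_t=\mathcal{L}_\Gamma w$ in $L^2(X_\Gamma,\mu_\Gamma)$ with $w(0)=e^{-h_0/2}$. Then there are positive constants $c_1,c_2,c_3,c_4$, depending only on $\Gamma$ and $(c_e)_{e\in E}$, such that for every $s_0\in X_\Gamma$ the following hold. (i) If $h_0\in W^{1,2}(X_\Gamma,\mu_\Gamma)$ satisfies $h_0(s_0)=0$ and $u$ is the Cole–Hopf solution with initial condition $u_0=dh_0$, then $$\sup_{t>0}\|u(t)\|\le c_1\,\|u_0\|\,e^{c_2\|u_0\|}.$$ (ii) If moreover $\widetilde h_0\in W^{1,2}(X_\Gamma,\mu_\Gamma)$ satisfies $\widetilde h_0(s_0)=0$ and $\widetilde u$ is the Cole–Hopf solution with initial condition $\widetilde u_0=d\widetilde h_0$, then $$\sup_{t>0}\|u(t)-\widetilde u(t)\|\le c_3\,(\|u_0\|+1)^2\,e^{c_4(\|u_0\|+\|\widetilde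 u_0\|)}\,\|u_0-\widetilde u_0\|.$$ -/

import Mathlib

open MeasureTheory Set
open scoped ContDiff

noncomputable section

/-- A metric graph all of whose edges have finite length: every edge `e` is an interval `(0, len e)`
with an initial vertex `init e` and a terminal vertex `term e`. -/
structure MetricGraph (V E : Type*) where
  len : E → ℝ
  len_pos : ∀ e, 0 < len e
  init : E → V
  term : E → V

namespace MetricGraph

/-- The edge `e` and the vertex `p` are incident. -/
def Incident {V E : Type*} (Γ : MetricGraph V E) (e : E) (p : V) : Prop :=
  p = Γ.init e ∨ p = Γ.term e

/-- Two distinct vertices incident to the same edge. -/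
def Neighbor {V E : Type*} (Γ : MetricGraph V E) (p q : V) : Prop :=
  p ≠ q ∧ ∃ e, Γ.Incident e p ∧ Γ.Incident e q

/-- Any two distinct vertices are joined by a finite chain of neighbors. -/
def Connected {V E : Type*} (Γ : MetricGraph V E) : Prop :=
  ∀ p q : V, p ≠ q → Relation.ReflTransGen Γ.Neighbor p q

def NoLoops {V E : Type*} (Γ : MetricGraph V E) : Prop :=
  ∀ e, Γ.init e ≠ Γ.term e

def NoMultipleEdges {V E : Type*} (Γ : MetricGraph V E) : Prop :=
  ∀ e e' : E, e ≠ e' →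
    ({Γ.init e, Γ.term e} : Set V) ≠ ({Γ.init e', Γ.term e'} : Set V)

/-- The set `X_Γ`: the disjoint union of the vertex set and of the open edges `{e} × (0, len e)`. -/
inductive Space {V E : Type*} (Γ : MetricGraph V E) where
  | vertex (v : V) : Space Γ
  | inner (e : E) (s : Ioo (0 : ℝ) (Γ.len e)) : Space Γ

/-- The inverse of the coordinate `π_e` on the closed edge: `s ∈ (0, len e)` is sent to the point
`(e, s)`, `0` to the initial and `len e` to the terminal vertex. (Extended to the real line by
constants.) -/
def par {V E : Type*} (Γ : MetricGraph V E) (e : E) (s : ℝ) : Γ.Space :=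
  if h : 0 < s ∧ s < Γ.len e then .inner e ⟨s, h⟩
  else if s ≤ 0 then .vertex (Γ.init e) else .vertex (Γ.term e)

/-- The topology of `X_Γ`: a set is open when its trace on each closed edge `[0, len e]` is. -/
instance {V E : Type*} (Γ : MetricGraph V E) : TopologicalSpace Γ.Space :=
  ⨆ e : E, TopologicalSpace.coinduced (fun s : Icc (0 : ℝ) (Γ.len e) => Γ.par e s) inferInstance

instance {V E : Type*} (Γ : MetricGraph V E) : MeasurableSpace Γ.Space := borel _

instance {V E : Type*} (Γ : MetricGraph V E) : BorelSpace Γ.Space := ⟨rfl⟩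

/-- `par e` is continuous, hence measurable, so that the image measures below are meaningful. -/
theorem continuous_par {V E : Type*} (Γ : MetricGraph V E) (e : E) : Continuous (Γ.par e) := by
  have h1 : Continuous (fun s : Icc (0 : ℝ) (Γ.len e) => Γ.par e s) :=
    continuous_iff_coinduced_le.2
      (le_iSup (fun e : E => TopologicalSpace.coinduced
        (fun s : Icc (0 : ℝ) (Γ.len e) => Γ.par e s) inferInstance) e)
  have h2 : Γ.par e = (fun s : Icc (0 : ℝ) (Γ.len e) => Γ.par e s) ∘
      Set.projIcc 0 (Γ.len e) (Γ.len_pos e).le := by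
    funext s
    have hl := Γ.len_pos e
    rcases le_or_gt s 0 with hs | hs
    · simp [Set.projIcc_of_le_left _ hs, par, not_lt.2 hs, hs]
    · rcases le_or_gt (Γ.len e) s with hs' | hs'
      · simp [Set.projIcc_of_right_le _ hs', par, not_lt.2 hs', not_le.2 hl, not_le.2 hs]
      · simp [Set.projIcc_of_mem (Γ.len_pos e).le ⟨hs.le, hs'.le⟩]
  rw [h2]
  exact h1.comp continuous_projIcc

/-- The measure `μ_Γ` on `X_Γ` whose image on each edge `e` is `c e` times Lebesgue measure; the
vertices are null. -/
def measure {V E : Type*} (Γ : MetricGraph V E) (c : E → ℝ) : Measure Γ.Space :=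
  Measure.sum fun e =>
    ENNReal.ofReal (c e) • (volume.restrict (Ioo (0 : ℝ) (Γ.len e))).map (Γ.par e)

/-- `L²(X_Γ, μ_Γ)`. -/
abbrev L2 {V E : Type*} (Γ : MetricGraph V E) (c : E → ℝ) : Type _ :=
  Lp ℝ 2 (Γ.measure c)

/-- `g` is the distributional derivative of `f` on the interval `(0, l)`. -/
def HasWeakDeriv (l : ℝ) (f g : ℝ → ℝ) : Prop :=
  ∀ φ : ℝ → ℝ, ContDiff ℝ ∞ φ → HasCompactSupport φ → tsupport φ ⊆ Ioo 0 l →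
    ∫ s in Ioo 0 l, f s * deriv φ s = - ∫ s in Ioo 0 l, g s * φ s

/-- `f ∈ W^{1,2}(X_Γ, μ_Γ)` and `d f = v`: the function `f` is continuous on `X_Γ` and, for every
edge `e`, its restriction `f_e` to `e` has a distributional derivative `f_e'` in `L²`, where
`v_e = (c e)^{-1/2} f_e'`. As `v` is in `L²(X_Γ, μ_Γ)`, the function `f` has finite energy
`∑ e, ∫ (f_e')² = ‖v‖²`. -/
def HasGrad {V E : Type*} (Γ : MetricGraph V E) (c : E → ℝ) (f : Γ.Space → ℝ) (v : Γ.L2 c) : Prop :=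
  Continuous f ∧
    ∀ e, HasWeakDeriv (Γ.len e) (fun s => f (Γ.par e s)) (fun s => √(c e) * v (Γ.par e s))

/-- `v` belongs to the domain of the adjoint `d^*` in `L²(X_Γ, μ_Γ)` of the operator `d` with domain
`W^{1,2}(X_Γ, μ_Γ)`, and `d^* v = g`. -/
def HasAdjGrad {V E : Type*} (Γ : MetricGraph V E) (c : E → ℝ) (v g : Γ.L2 c) : Prop :=
  ∀ (φ : Γ.Space → ℝ) (dφ : Γ.L2 c), Γ.HasGrad c φ dφ →
    inner ℝ v dφ = ∫ x, g x * φ x ∂(Γ.measure c)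

/-- `F` belongs to the domain of the Kirchhoff Laplacian `𝓛_Γ = - d^* d` and `𝓛_Γ F = G`. That is,
`𝓛_Γ` is the generator of the Dirichlet form `(𝓔_Γ, W^{1,2}(X_Γ, μ_Γ))`,
`𝓔_Γ(f, g) = ⟨d f, d g⟩`. -/
def HasLaplacian {V E : Type*} (Γ : MetricGraph V E) (c : E → ℝ) (F G : Γ.L2 c) : Prop :=
  ∃ (f : Γ.Space → ℝ) (v : Γ.L2 c),
    F =ᵐ[Γ.measure c] f ∧ Γ.HasGrad c f v ∧ Γ.HasAdjGrad c v (-G)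

/-- `W` is the solution in `L²(X_Γ, μ_Γ)` of the heat equation `W_t = 𝓛_Γ W`, `t > 0`, with initial
condition `W(0) = w₀`; that is, `W(t) = e^{t 𝓛_Γ} w₀`. -/
structure IsHeatSolution {V E : Type*} (Γ : MetricGraph V E) (c : E → ℝ) (w₀ : Γ.Space → ℝ)
    (W : ℝ → Γ.L2 c) : Prop where
  initial : W 0 =ᵐ[Γ.measure c] w₀
  continuousOn : ContinuousOn W (Ici 0)
  contDiffOn : ContDiffOn ℝ 1 W (Ioi 0)
  heat : ∀ t, 0 < t → Γ.HasLaplacian c (W t) (deriv W t)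

/-- `u(t) = - 2 d log w(t)`, `t ≥ 0`, where `w(t) = e^{t 𝓛_Γ} w₀` with `w₀ = e^{-h₀/2}`: the
Cole-Hopf solution of the Burgers equation with initial condition `d h₀`. The logarithm is taken of
the continuous representative of `w(t)`. -/
def IsColeHopfSolution {V E : Type*} (Γ : MetricGraph V E) (c : E → ℝ) (h₀ : Γ.Space → ℝ)
    (u : ℝ → Γ.L2 c) : Prop :=
  ∃ W : ℝ → Γ.L2 c, Γ.IsHeatSolution c (fun x => Real.exp (-h₀ x / 2)) W ∧
    ∀ t, 0 ≤ t → ∃ w : Γ.Space → ℝ, Continuous w ∧ W t =ᵐ[Γ.measure c] w ∧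
      Γ.HasGrad c (fun x => -2 * Real.log (w x)) (u t)

end MetricGraph

end

/-! The Cole–Hopf substitution turns `u = -2 d log w` into the relation `d w = - w u / 2`, so `u` is
controlled by the energy of a heat solution `w` and a positive lower bound for it. Three facts
supply these.

Oscillation (`exists_osc_bound`): on a connected finite graph `|f x - f y| ≤ C ‖d f‖`. With `h₀ s₀ =
0` this gives `|h₀| ≤ B = C ‖u₀‖`, hence `e^{-B/2} ≤ w(0) ≤ e^{B/2}`. Maximum principle
(`IsHeatSolution.le_of_initial_le`): bounds on `w(0)` persist for `w(t)`. Energy decay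
(`IsHeatSolution.norm_grad_le`): `‖d w(t)‖ ≤ ‖d w(0)‖`.

Therefore `‖u(t)‖ ≤ 2 e^{B/2} ‖d w(t)‖ ≤ 2 e^{B/2} ‖d w(0)‖ ≤ e^B ‖u₀‖`, which is (i). For (ii), `w'
(u - u') = -(w - w') u - 2 (d w - d w')`. The difference `w - w'` again solves the heat equation, so
its supremum and its energy are bounded by their initial values, which are small with `‖u₀ - u₀'‖`.

No spectral theory or semigroup theory enters: everything about the heat flow follows from the weak
form `⟨d w, d f⟩ = -⟨w_t, f⟩` with well-chosen `f`. -/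

/-! ### Weak derivatives on an interval -/

theorem AbsolutelyContinuousOnInterval.comp_lipschitzOnWith {f φ : ℝ → ℝ} {a b : ℝ} {K : NNReal}
    {s : Set ℝ} (hf : AbsolutelyContinuousOnInterval f a b) (hφ : LipschitzOnWith K φ s)
    (hs : MapsTo f (uIcc a b) s) : AbsolutelyContinuousOnInterval (fun x => φ (f x)) a b := by
  have h := Filter.Tendsto.const_mul (K : ℝ) hf
  rw [mul_zero] at h
  refine squeeze_zero' (.of_forall fun E => Finset.sum_nonneg fun _ _ => dist_nonneg) ?_ h
  refine Filter.eventually_inf_principal.2 (.of_forall fun E hE => ?_)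
  rw [Finset.mul_sum]
  exact Finset.sum_le_sum fun i hi =>
    hφ.dist_le_mul _ (hs (hE.1 i hi).1) _ (hs (hE.1 i hi).2)

namespace MetricGraph

theorem HasWeakDeriv.of_absolutelyContinuous {l : ℝ} {f g : ℝ → ℝ} (hl : 0 < l)
    (hf : AbsolutelyContinuousOnInterval f 0 l)
    (hg : ∀ᵐ x, x ∈ Ioo 0 l → deriv f x = g x) : HasWeakDeriv l f g := by
  intro φ hφ _ hsupp
  have hφac : AbsolutelyContinuousOnInterval φ 0 l :=
    (hφ.of_le (by exact_mod_cast le_top)).contDiffOn.absolutelyContinuousOnInterval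
  have h := hf.integral_mul_deriv_eq_deriv_mul hφac
  have h0 : φ 0 = 0 := image_eq_zero_of_notMem_tsupport fun h => (hsupp h).1.false
  have h1 : φ l = 0 := image_eq_zero_of_notMem_tsupport fun h => (hsupp h).2.false
  rw [h0, h1, intervalIntegral.integral_of_le hl.le, intervalIntegral.integral_of_le hl.le,
    integral_Ioc_eq_integral_Ioo, integral_Ioc_eq_integral_Ioo] at h
  rw [h, mul_zero, mul_zero, sub_zero, zero_sub]
  congr 1
  refine setIntegral_congr_ae measurableSet_Ioo ?_
  filter_upwards [hg] with x hx hx'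
  rw [hx hx']

/-- Du Bois-Reymond's argument: fix a bump `ρ` of integral one. For a test function `ψ`, the
function `ψ - (∫ ψ) ρ` has mean zero, so its primitive is again a test function. Testing against
that primitive shows that `k - ∫ k ρ` is orthogonal to `ψ`. -/
theorem HasWeakDeriv.eqOn_const {l : ℝ} {k : ℝ → ℝ} (hl : 0 < l) (hk : Continuous k)
    (h : HasWeakDeriv l k fun _ => 0) : ∃ C, ∀ x ∈ Icc 0 l, k x = C := by
  let b : ContDiffBump (l / 2) := ⟨l / 8, l / 4, by positivity, by linarith⟩
  let ρ : ℝ → ℝ := b.normed volume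
  have hρ : ContDiff ℝ ∞ ρ := b.contDiff_normed
  have hρc : HasCompactSupport ρ := b.hasCompactSupport_normed
  have hρi : ∫ x, ρ x = 1 := b.integral_normed
  have hρs : tsupport ρ ⊆ Ioo 0 l := by
    intro x hx
    have : x ∈ Metric.closedBall (l / 2) (l / 4) := by
      rw [← b.tsupport_normed_eq (μ := volume)]; exact hx
    rw [Metric.mem_closedBall, Real.dist_eq, abs_le] at this
    constructor <;> linarith [this.1, this.2]
  have hloc : ∀ φ : ℝ → ℝ, tsupport φ ⊆ Ioo 0 l → ∀ f : ℝ → ℝ,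
      ∫ x in Ioo 0 l, f x * φ x = ∫ x, f x * φ x := fun φ hφ f =>
    setIntegral_eq_integral_of_forall_compl_eq_zero fun x hx => by
      rw [image_eq_zero_of_notMem_tsupport fun h => hx (hφ h), mul_zero]
  have hint : ∀ φ : ℝ → ℝ, ContDiff ℝ ∞ φ → HasCompactSupport φ → ∀ f : ℝ → ℝ, Continuous f →
      Integrable fun x => f x * φ x := fun φ hφ hφc f hf =>
    (hf.mul hφ.continuous).integrable_of_hasCompactSupport hφc.mul_left
  set C := ∫ x, k x * ρ x with hC
  have key : ∀ᵐ x, x ∈ Ioo 0 l → k x - C = 0 := by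
    refine isOpen_Ioo.ae_eq_zero_of_integral_contDiff_smul_eq_zero
      ((hk.sub continuous_const).locallyIntegrable.locallyIntegrableOn _) fun ψ hψ hψc hψs => ?_
    let θ : ℝ → ℝ := fun x => ψ x - (∫ y, ψ y) * ρ x
    have hθ : ContDiff ℝ ∞ θ := hψ.sub (contDiff_const.mul hρ)
    let η : ℝ → ℝ := fun x => ∫ y in (0 : ℝ)..x, θ y
    have hη' : ∀ x, HasDerivAt η (θ x) x := fun x => hθ.continuous.integral_hasStrictDerivAt 0 x
      |>.hasDerivAt
    have hdη : deriv η = θ := funext fun x => (hη' x).deriv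
    have hη : ContDiff ℝ ∞ η := by
      rw [contDiff_infty_iff_deriv, hdη]
      exact ⟨fun x => (hη' x).differentiableAt, hθ⟩
    -- One interval `[a, d]` inside `(0, l)` contains both supports, so `η` vanishes off it: on the
    -- left trivially, on the right because `θ` has mean zero. Inserting `l / 2` only guarantees
    -- that the compact set is nonempty.
    obtain ⟨a, ha, d, hd, hK⟩ : ∃ a, 0 < a ∧ ∃ d, d < l ∧ tsupport ψ ∪ tsupport ρ ⊆ Icc a d := by
      have hcK : IsCompact (insert (l / 2) (tsupport ψ ∪ tsupport ρ)) :=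
        (hψc.isCompact.union hρc.isCompact).insert _
      have hsub : insert (l / 2) (tsupport ψ ∪ tsupport ρ) ⊆ Ioo 0 l :=
        insert_subset ⟨by positivity, by linarith⟩ (union_subset hψs hρs)
      obtain ⟨a, ha⟩ := hcK.exists_isLeast (insert_nonempty _ _)
      obtain ⟨d, hd⟩ := hcK.exists_isGreatest (insert_nonempty _ _)
      exact ⟨a, (hsub ha.1).1, d, (hsub hd.1).2, fun x hx =>
        ⟨ha.2 (mem_insert_of_mem _ hx), hd.2 (mem_insert_of_mem _ hx)⟩⟩
    have hθ0 : ∀ x, x ∉ Icc a d → θ x = 0 := fun x hx => by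
      have h1 : ψ x = 0 := image_eq_zero_of_notMem_tsupport fun h => hx (hK (.inl h))
      have h2 : ρ x = 0 := image_eq_zero_of_notMem_tsupport fun h => hx (hK (.inr h))
      simp [θ, h1, h2]
    have hψi : Integrable ψ := hψ.continuous.integrable_of_hasCompactSupport hψc
    have hρi' : Integrable ρ := hρ.continuous.integrable_of_hasCompactSupport hρc
    have hθi : ∫ x, θ x = 0 := by
      rw [integral_sub hψi (hρi'.const_mul _), integral_const_mul, hρi, mul_one, sub_self]
    have hη0 : ∀ x, x ∉ Icc a d → η x = 0 := fun x hx => by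
      rcases lt_or_ge x a with hxa | hxa
      · refine (intervalIntegral.integral_congr (g := fun _ => 0) fun y hy => ?_).trans (by simp)
        refine hθ0 y fun hy' => ?_
        have := hy.2
        have h3 : max 0 x < a := max_lt ha hxa
        linarith [hy'.1]
      · have hxd : d < x := not_le.1 fun h => hx ⟨hxa, h⟩
        refine (intervalIntegral.integral_eq_integral_of_support_subset fun y hy => ?_).trans hθi
        have hy' : y ∈ Icc a d := by_contra fun h => hy (hθ0 y h)
        exact ⟨by linarith [hy'.1], by linarith [hy'.2]⟩
    have hηs : tsupport η ⊆ Icc a d :=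
      closure_minimal (fun x hx => by_contra fun h => hx (hη0 x h)) isClosed_Icc
    have := h η hη (isCompact_Icc.of_isClosed_subset isClosed_closure hηs)
      (hηs.trans fun x hx => ⟨ha.trans_le hx.1, hx.2.trans_lt hd⟩)
    have hθs' : tsupport θ ⊆ Icc a d :=
      closure_minimal (fun x hx => by_contra fun h => hx (hθ0 x h)) isClosed_Icc
    have hθs : tsupport θ ⊆ Ioo 0 l :=
      hθs'.trans fun x hx => ⟨ha.trans_le hx.1, hx.2.trans_lt hd⟩
    rw [hdη, hloc θ hθs] at this
    simp only [zero_mul, integral_zero, neg_zero, θ, mul_sub] at this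
    rw [integral_sub (hint ψ hψ hψc k hk)] at this
    · simp_rw [mul_left_comm (k _)] at this
      rw [integral_const_mul, ← hC] at this
      simp only [smul_eq_mul, mul_sub]
      simp_rw [mul_comm (ψ _)]
      rw [integral_sub (hint ψ hψ hψc k hk) (hint ψ hψ hψc _ continuous_const),
        integral_const_mul, mul_comm C]
      exact this
    · simp_rw [mul_left_comm (k _)]
      exact (hint ρ hρ hρc k hk).const_mul _
  refine ⟨C, ?_⟩
  have h1 : EqOn k (fun _ => C) (Ioo 0 l) := by
    refine Measure.eqOn_open_of_ae_eq (μ := volume) ?_ isOpen_Ioo hk.continuousOn continuousOn_const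
    exact (ae_restrict_iff' measurableSet_Ioo).2 (key.mono fun x hx hx' => sub_eq_zero.1 (hx hx'))
  have h2 := h1.closure hk continuous_const
  rwa [closure_Ioo hl.ne] at h2

theorem HasWeakDeriv.sub {l : ℝ} {f f' g g' : ℝ → ℝ} (hf : Continuous f) (hf' : Continuous f')
    (hg : IntegrableOn g (Ioo 0 l)) (hg' : IntegrableOn g' (Ioo 0 l))
    (h : HasWeakDeriv l f g) (h' : HasWeakDeriv l f' g') :
    HasWeakDeriv l (fun x => f x - f' x) fun x => g x - g' x := by
  intro φ hφ hφc hφs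
  have hd : Continuous (deriv φ) := hφ.continuous_deriv (by simp)
  have hi : ∀ k : ℝ → ℝ, Continuous k → IntegrableOn (fun x => k x * deriv φ x) (Ioo 0 l) :=
    fun k hk => ((hk.mul hd).integrable_of_hasCompactSupport
      (hφc.deriv (𝕜 := ℝ)).mul_left).integrableOn
  obtain ⟨B, hB⟩ := hφc.exists_bound_of_continuous hφ.continuous
  have hj : ∀ k : ℝ → ℝ, IntegrableOn k (Ioo 0 l) → IntegrableOn (fun x => k x * φ x) (Ioo 0 l) :=
    fun k hk => hk.mul_bdd (c := B) hφ.continuous.aestronglyMeasurable (.of_forall hB)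
  simp_rw [sub_mul]
  rw [integral_sub (hi f hf) (hi f' hf'), integral_sub (hj g hg) (hj g' hg'), h φ hφ hφc hφs,
    h' φ hφ hφc hφs]
  ring

theorem HasWeakDeriv.congr_left {l : ℝ} {f f' g : ℝ → ℝ} (h : HasWeakDeriv l f g)
    (hf : f =ᵐ[volume.restrict (Ioo 0 l)] f') : HasWeakDeriv l f' g := by
  intro φ hφ hφc hφs
  rw [← h φ hφ hφc hφs]
  refine integral_congr_ae ?_
  filter_upwards [hf] with x hx
  rw [hx]

theorem HasWeakDeriv.congr_right {l : ℝ} {f g g' : ℝ → ℝ} (h : HasWeakDeriv l f g)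
    (hg : g =ᵐ[volume.restrict (Ioo 0 l)] g') : HasWeakDeriv l f g' := by
  intro φ hφ hφc hφs
  rw [h φ hφ hφc hφs]
  congr 1
  refine integral_congr_ae ?_
  filter_upwards [hg] with x hx
  rw [hx]

theorem HasWeakDeriv.unique {l : ℝ} {f g g' : ℝ → ℝ} (hg : IntegrableOn g (Ioo 0 l))
    (hg' : IntegrableOn g' (Ioo 0 l)) (h : HasWeakDeriv l f g) (h' : HasWeakDeriv l f g') :
    g =ᵐ[volume.restrict (Ioo 0 l)] g' := by
  refine (ae_restrict_iff' measurableSet_Ioo).2 ?_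
  have := isOpen_Ioo.ae_eq_zero_of_integral_contDiff_smul_eq_zero
    (hg.sub hg').locallyIntegrableOn fun φ hφ hφc hφs => by
      obtain ⟨B, hB⟩ := hφc.exists_bound_of_continuous hφ.continuous
      have hj : ∀ k : ℝ → ℝ, IntegrableOn k (Ioo 0 l) →
          IntegrableOn (fun x => k x * φ x) (Ioo 0 l) :=
        fun k hk => hk.mul_bdd (c := B) hφ.continuous.aestronglyMeasurable (.of_forall hB)
      rw [← setIntegral_eq_integral_of_forall_compl_eq_zero (s := Ioo 0 l) fun x hx => by
        rw [image_eq_zero_of_notMem_tsupport fun h => hx (hφs h), zero_smul]]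
      simp only [smul_eq_mul, Pi.sub_apply, mul_comm (φ _), sub_mul]
      rw [integral_sub (hj g hg) (hj g' hg'), sub_eq_zero, ← neg_inj, ← h φ hφ hφc hφs,
        ← h' φ hφ hφc hφs]
  filter_upwards [this] with x hx hx'
  exact sub_eq_zero.1 (hx hx')

/-- The primitive of `g` also has weak derivative `g`, so its difference from `f` is constant. -/
theorem HasWeakDeriv.eq_add_integral {l : ℝ} {f g : ℝ → ℝ} (hl : 0 < l) (hf : Continuous f)
    (hg : IntegrableOn g (Ioo 0 l)) (h : HasWeakDeriv l f g) :
    ∀ x ∈ Icc 0 l, f x = f 0 + ∫ y in (0 : ℝ)..x, g y := by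
  have hG : IntervalIntegrable g volume 0 l :=
    (intervalIntegrable_iff_integrableOn_Ioo_of_le hl.le).2 hg
  have hac := hG.absolutelyContinuousOnInterval_intervalIntegral (c := 0) left_mem_uIcc
  -- Nothing is known about `g` outside `(0, l)`, whereas `HasWeakDeriv.eqOn_const` asks for
  -- continuity on the whole line; hence the extension by constants.
  let G : ℝ → ℝ := IccExtend hl.le ((Icc 0 l).domRestrict fun x => ∫ y in (0 : ℝ)..x, g y)
  have hGc : Continuous G :=
    (continuousOn_iff_continuous_domRestrict.1 (uIcc_of_le hl.le ▸ hac.continuousOn)).Icc_extend'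
  have hGe : ∀ x ∈ Icc 0 l, G x = ∫ y in (0 : ℝ)..x, g y := fun x hx => by
    simp only [G, IccExtend_of_mem hl.le _ hx]; rfl
  have hGw : HasWeakDeriv l G g := by
    refine (HasWeakDeriv.of_absolutelyContinuous (g := g) hl hac ?_).congr_left ?_
    · filter_upwards [hG.ae_hasDerivAt_integral] with x hx hx'
      exact (hx (uIcc_of_le hl.le ▸ Ioo_subset_Icc_self hx') 0 left_mem_uIcc).deriv
    · exact (ae_restrict_iff' measurableSet_Ioo).2
        (.of_forall fun x hx => (hGe x (Ioo_subset_Icc_self hx)).symm)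
  obtain ⟨C, hC⟩ := HasWeakDeriv.eqOn_const hl (hf.sub hGc)
    ((h.sub hf hGc hg hg hGw).congr_right (.of_forall fun x => sub_self (g x)))
  intro x hx
  have h1 := hC x hx
  have h2 := hC 0 ⟨le_rfl, hl.le⟩
  simp only [Pi.sub_apply] at h1 h2
  rw [hGe x hx] at h1
  rw [hGe 0 ⟨le_rfl, hl.le⟩, intervalIntegral.integral_same] at h2
  linarith

/-- On `[0, l]` the function `f` is absolutely continuous with bounded range, and `φ` is Lipschitz
on that range. So `φ ∘ f` is absolutely continuous and the classical chain rule holds almost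
everywhere. -/
theorem HasWeakDeriv.comp {l : ℝ} {f g φ : ℝ → ℝ} (hl : 0 < l) (hf : Continuous f)
    (hg : IntegrableOn g (Ioo 0 l)) (h : HasWeakDeriv l f g) (hφ : ContDiff ℝ 1 φ) :
    HasWeakDeriv l (fun x => φ (f x)) fun x => deriv φ (f x) * g x := by
  have hG : IntervalIntegrable g volume 0 l :=
    (intervalIntegrable_iff_integrableOn_Ioo_of_le hl.le).2 hg
  have hI := hG.absolutelyContinuousOnInterval_intervalIntegral (c := 0) left_mem_uIcc
  set F : ℝ → ℝ := fun x => f 0 + ∫ y in (0 : ℝ)..x, g y with hF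
  have hFac : AbsolutelyContinuousOnInterval F 0 l :=
    ((LipschitzWith.const (f 0)).lipschitzOnWith.absolutelyContinuousOnInterval).add hI
  have hfF := h.eq_add_integral hl hf hg
  obtain ⟨B, hB⟩ := hFac.exists_bound
  obtain ⟨K, hK⟩ := hφ.contDiffOn.exists_lipschitzOnWith (s := Icc (-B) B)
    (by simp) (convex_Icc _ _) isCompact_Icc
  have hc := hFac.comp_lipschitzOnWith hK
    fun x hx => abs_le.1 (hB x hx)
  refine (HasWeakDeriv.of_absolutelyContinuous (g := fun x => deriv φ (f x) * g x) hl hc ?_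
    ).congr_left ?_
  · filter_upwards [hG.ae_hasDerivAt_integral] with x hx hx'
    have hxI := Ioo_subset_Icc_self hx'
    have h1 : HasDerivAt F (g x) x :=
      (hx (uIcc_of_le hl.le ▸ hxI) 0 left_mem_uIcc).const_add (f 0)
    rw [hfF x hxI]
    exact ((hφ.differentiable (by simp) _).hasDerivAt.comp x h1).deriv
  · exact (ae_restrict_iff' measurableSet_Ioo).2
      (.of_forall fun x hx => by rw [hF]; simp only [← hfF x (Ioo_subset_Icc_self hx)])

end MetricGraph

/-! ### The gradient on the graph and the oscillation bound -/

namespace MetricGraph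

variable {V E : Type*} {Γ : MetricGraph V E} {c : E → ℝ}

theorem par_zero (Γ : MetricGraph V E) (e : E) : Γ.par e 0 = .vertex (Γ.init e) := by
  simp [par]

theorem par_len (Γ : MetricGraph V E) (e : E) : Γ.par e (Γ.len e) = .vertex (Γ.term e) := by
  simp [par, (Γ.len_pos e).not_ge]

theorem ae_par [Finite E] (hc : ∀ e, 0 < c e) {p : Γ.Space → Prop}
    (h : ∀ᵐ x ∂Γ.measure c, p x) (e : E) :
    ∀ᵐ s ∂volume.restrict (Ioo 0 (Γ.len e)), p (Γ.par e s) := by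
  have h1 := Measure.ae_sum_iff.1 h e
  rw [Measure.ae_ennreal_smul_measure_iff (by simpa using hc e)] at h1
  exact ae_of_ae_map (Γ.continuous_par e).measurable.aemeasurable h1

theorem ae_of_ae_par [Finite E] {p : Γ.Space → Prop} (hp : MeasurableSet {x | p x})
    (h : ∀ e, ∀ᵐ s ∂volume.restrict (Ioo 0 (Γ.len e)), p (Γ.par e s)) :
    ∀ᵐ x ∂Γ.measure c, p x := by
  refine Measure.ae_sum_iff.2 fun e => Measure.ae_smul_measure ?_ _
  exact (ae_map_iff (Γ.continuous_par e).measurable.aemeasurable hp).2 (h e)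

instance [Finite E] : IsFiniteMeasure (Γ.measure c) := by
  have := Fintype.ofFinite E
  rw [measure, Measure.sum_fintype]
  have : ∀ e, IsFiniteMeasure (ENNReal.ofReal (c e) •
      (volume.restrict (Ioo (0 : ℝ) (Γ.len e))).map (Γ.par e)) := fun e =>
    Measure.smul_finite _ ENNReal.ofReal_ne_top
  infer_instance

theorem memLp_par (hc : ∀ e, 0 < c e) (v : Γ.L2 c) (e : E) :
    MemLp (fun s => v (Γ.par e s)) 2 (volume.restrict (Ioo 0 (Γ.len e))) := by
  have hm := (Γ.continuous_par e).measurable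
  have hc' : ENNReal.ofReal (c e) ≠ 0 := by simpa using hc e
  have h1 : (volume.restrict (Ioo (0 : ℝ) (Γ.len e))).map (Γ.par e) ≤
      (ENNReal.ofReal (c e))⁻¹ • Γ.measure c := by
    have h2 := Measure.le_sum (fun e =>
      ENNReal.ofReal (c e) • (volume.restrict (Ioo (0 : ℝ) (Γ.len e))).map (Γ.par e)) e
    refine le_of_eq_of_le ?_ (smul_mono_right _ h2)
    rw [smul_smul, ENNReal.inv_mul_cancel hc' ENNReal.ofReal_ne_top, one_smul]
  exact ((Lp.memLp v).of_measure_le_smul (ENNReal.inv_ne_top.2 hc') h1).comp_of_map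
    hm.aemeasurable

theorem integrableOn_par (hc : ∀ e, 0 < c e) (v : Γ.L2 c) (e : E) :
    IntegrableOn (fun s => √(c e) * v (Γ.par e s)) (Ioo 0 (Γ.len e)) :=
  ((memLp_par hc v e).integrable one_le_two).const_mul _

theorem exists_integral_par_le [Finite E] (hc : ∀ e, 0 < c e) (e : E) :
    ∃ K, 0 ≤ K ∧ ∀ v : Γ.L2 c,
      ∫ s in Ioo 0 (Γ.len e), ‖√(c e) * v (Γ.par e s)‖ ≤ K * ‖v‖ := by
  let I : Γ.L2 c := Lp.const 2 (Γ.measure c) 1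
  -- Cauchy–Schwarz against the constant `1`, which lies in `L²` as the measure is finite. The
  -- factor `(c e)⁻¹` passes from `μ_Γ` to Lebesgue measure on the edge.
  refine ⟨√(c e) * (c e)⁻¹ * ‖I‖, mul_nonneg (mul_nonneg (Real.sqrt_nonneg _)
    (inv_nonneg.2 (hc e).le)) (norm_nonneg _), fun v => ?_⟩
  have h1 : ∫ x, |v x| ∂Γ.measure c ≤ ‖I‖ * ‖v‖ := by
    have h := real_inner_le_norm I |v|
    rw [norm_abs_eq_norm, L2.inner_def] at h
    refine le_of_eq_of_le (integral_congr_ae ?_) h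
    filter_upwards [Lp.coeFn_abs v, Lp.coeFn_const (p := 2) (μ := Γ.measure c) (1 : ℝ)]
      with x hx hx'
    rw [show (I : Γ.Space → ℝ) x = 1 from hx', hx]
    simp
  have hvi : Integrable (fun x => |v x|) (Γ.measure c) :=
    ((Lp.memLp v).integrable one_le_two).abs
  have h2 := integral_mono_measure (Measure.le_sum (fun e =>
      ENNReal.ofReal (c e) • (volume.restrict (Ioo (0 : ℝ) (Γ.len e))).map (Γ.par e)) e)
      (.of_forall fun x => abs_nonneg (v x)) hvi
  rw [integral_smul_measure, integral_map (Γ.continuous_par e).measurable.aemeasurable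
    (Lp.stronglyMeasurable v).measurable.abs.aestronglyMeasurable,
    ENNReal.toReal_ofReal (hc e).le, smul_eq_mul] at h2
  have h3 := (le_inv_mul_iff₀ (hc e)).2 (h2.trans h1)
  simp only [norm_mul, Real.norm_eq_abs, abs_of_nonneg (Real.sqrt_nonneg (c e))]
  rw [integral_const_mul]
  calc _ ≤ √(c e) * ((c e)⁻¹ * (‖I‖ * ‖v‖)) :=
        mul_le_mul_of_nonneg_left h3 (Real.sqrt_nonneg _)
    _ = _ := by ring

theorem HasGrad.continuous_par {f : Γ.Space → ℝ} {v : Γ.L2 c} (h : Γ.HasGrad c f v) (e : E) :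
    Continuous fun s => f (Γ.par e s) := h.1.comp (Γ.continuous_par e)

theorem HasGrad.sub [Finite E] (hc : ∀ e, 0 < c e) {f f' : Γ.Space → ℝ} {v v' : Γ.L2 c}
    (h : Γ.HasGrad c f v) (h' : Γ.HasGrad c f' v') :
    Γ.HasGrad c (fun x => f x - f' x) (v - v') := by
  refine ⟨h.1.sub h'.1, fun e => ?_⟩
  refine ((h.2 e).sub (h.continuous_par e) (h'.continuous_par e) (integrableOn_par hc v e)
    (integrableOn_par hc v' e) (h'.2 e)).congr_right ?_
  filter_upwards [ae_par hc (Lp.coeFn_sub v v') e] with s hs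
  rw [hs, Pi.sub_apply, mul_sub]

theorem hasGrad_zero [Finite E] (hc : ∀ e, 0 < c e) : Γ.HasGrad c (fun _ => 0) 0 := by
  refine ⟨continuous_const, fun e φ _ _ _ => ?_⟩
  have : ∀ᵐ s ∂volume.restrict (Ioo 0 (Γ.len e)), √(c e) * (0 : Γ.L2 c) (Γ.par e s) * φ s = 0 := by
    filter_upwards [ae_par hc (Lp.coeFn_zero ℝ 2 (Γ.measure c)) e] with s hs
    rw [show (0 : Γ.L2 c) (Γ.par e s) = 0 from hs]
    simp
  rw [integral_congr_ae this]
  simp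

theorem HasGrad.congr [Finite E] (hc : ∀ e, 0 < c e) {f f' : Γ.Space → ℝ} {v : Γ.L2 c}
    (h : Γ.HasGrad c f v) (hf' : Continuous f') (hff' : f =ᵐ[Γ.measure c] f') :
    Γ.HasGrad c f' v :=
  ⟨hf', fun e => (h.2 e).congr_left (ae_par hc hff' e)⟩

theorem HasGrad.unique [Finite E] (hc : ∀ e, 0 < c e) {f : Γ.Space → ℝ} {v v' : Γ.L2 c}
    (h : Γ.HasGrad c f v) (h' : Γ.HasGrad c f v') : v = v' := by
  refine Lp.ext (ae_of_ae_par (measurableSet_eq_fun (Lp.stronglyMeasurable v).measurable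
    (Lp.stronglyMeasurable v').measurable) fun e => ?_)
  filter_upwards [(h.2 e).unique (integrableOn_par hc v e) (integrableOn_par hc v' e) (h'.2 e)]
    with s hs
  exact mul_left_cancel₀ (Real.sqrt_pos.2 (hc e)).ne' hs

theorem HasGrad.comp [Finite E] (hc : ∀ e, 0 < c e) {f : Γ.Space → ℝ} {v : Γ.L2 c} {φ : ℝ → ℝ}
    (h : Γ.HasGrad c f v) (hφ : ContDiff ℝ 1 φ) {B : ℝ} (hB : ∀ x, |deriv φ (f x)| ≤ B) :
    ∃ v' : Γ.L2 c, (v' =ᵐ[Γ.measure c] fun x => deriv φ (f x) * v x) ∧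
      Γ.HasGrad c (fun x => φ (f x)) v' := by
  have hm : MemLp (fun x => deriv φ (f x) * v x) 2 (Γ.measure c) := by
    refine (Lp.memLp v).of_le_mul (c := B) ?_ (.of_forall fun x => ?_)
    · exact ((hφ.continuous_deriv le_rfl).comp h.1).aestronglyMeasurable.mul
        (Lp.aestronglyMeasurable v)
    · rw [norm_mul]
      exact mul_le_mul_of_nonneg_right (hB x) (norm_nonneg _)
  refine ⟨hm.toLp _, hm.coeFn_toLp, hφ.continuous.comp h.1, fun e => ?_⟩
  refine ((h.2 e).comp (Γ.len_pos e) (h.continuous_par e) (integrableOn_par hc v e)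
    hφ).congr_right ?_
  filter_upwards [ae_par hc hm.coeFn_toLp e] with s hs
  rw [hs]
  ring

theorem exists_edge_bound [Finite E] (hc : ∀ e, 0 < c e) (e : E) :
    ∃ K, 0 ≤ K ∧ ∀ (f : Γ.Space → ℝ) (v : Γ.L2 c), Γ.HasGrad c f v →
      ∀ s ∈ Icc 0 (Γ.len e), |f (Γ.par e s) - f (.vertex (Γ.init e))| ≤ K * ‖v‖ := by
  obtain ⟨K, hK, h⟩ := exists_integral_par_le (Γ := Γ) hc e
  refine ⟨K, hK, fun f v hf s hs => le_trans ?_ (h v)⟩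
  have hi := integrableOn_par hc v e
  rw [(hf.2 e).eq_add_integral (Γ.len_pos e) (hf.continuous_par e) hi s hs, par_zero,
    add_sub_cancel_left, ← Real.norm_eq_abs, intervalIntegral.integral_of_le hs.1,
    integral_Ioc_eq_integral_Ioo]
  exact (norm_integral_le_integral_norm _).trans (setIntegral_mono_set hi.norm
    (.of_forall fun _ => norm_nonneg _) (Ioo_subset_Ioo_right hs.2).eventuallyLE)

theorem exists_vertex_bound [Finite E] (hc : ∀ e, 0 < c e) (hconn : Γ.Connected) (p q : V) :
    ∃ K, 0 ≤ K ∧ ∀ (f : Γ.Space → ℝ) (v : Γ.L2 c), Γ.HasGrad c f v →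
      |f (.vertex p) - f (.vertex q)| ≤ K * ‖v‖ := by
  by_cases hpq : p = q
  · exact ⟨0, le_rfl, fun f v _ => by simp [hpq]⟩
  induction hconn p q hpq with
  | refl => exact ⟨0, le_rfl, fun f v _ => by simp⟩
  | @tail b d _ hn ih =>
    -- The induction carries the hypothesis that the endpoints differ, so a chain returning to `p`
    -- is treated apart.
    obtain ⟨K, hK, h⟩ : ∃ K, 0 ≤ K ∧ ∀ (f : Γ.Space → ℝ) (v : Γ.L2 c), Γ.HasGrad c f v →
      |f (.vertex p) - f (.vertex b)| ≤ K * ‖v‖ := by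
      by_cases hpb : p = b
      · exact ⟨0, le_rfl, fun f v _ => by simp [hpb]⟩
      · exact ih hpb
    obtain ⟨_, e, hb, hd⟩ := hn
    obtain ⟨L, hL, hl⟩ := exists_edge_bound (Γ := Γ) hc e
    have aux : ∀ r, Γ.Incident e r → ∀ (f : Γ.Space → ℝ) (v : Γ.L2 c), Γ.HasGrad c f v →
        |f (.vertex r) - f (.vertex (Γ.init e))| ≤ L * ‖v‖ := by
      rintro r (rfl | rfl) f v hf
      · simpa using mul_nonneg hL (norm_nonneg v)
      · rw [← par_len]
        exact hl f v hf _ ⟨(Γ.len_pos e).le, le_rfl⟩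
    -- Crossing the last edge is measured through its initial vertex, at cost `L` for each of the
    -- two ends.
    refine ⟨K + L + L, by positivity, fun f v hf => ?_⟩
    have h1 := abs_le.1 (h f v hf)
    have h2 := abs_le.1 (aux b hb f v hf)
    have h3 := abs_le.1 (aux d hd f v hf)
    rw [abs_le]
    constructor <;> linarith [h1.1, h1.2, h2.1, h2.2, h3.1, h3.2]

/-- There are no isolated vertices once an edge exists: the first link of a chain from `p` to an end
of `e₀` supplies an edge at `p`. -/
theorem exists_par_eq (hconn : Γ.Connected) (e₀ : E) (x : Γ.Space) :
    ∃ e, ∃ s ∈ Icc 0 (Γ.len e), Γ.par e s = x := by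
  have key : ∀ e r, Γ.Incident e r → ∃ e, ∃ s ∈ Icc 0 (Γ.len e), Γ.par e s = .vertex r := by
    rintro e r (rfl | rfl)
    · exact ⟨e, 0, ⟨le_rfl, (Γ.len_pos e).le⟩, par_zero Γ e⟩
    · exact ⟨e, _, ⟨(Γ.len_pos e).le, le_rfl⟩, par_len Γ e⟩
  cases x with
  | inner e s => exact ⟨e, s, Ioo_subset_Icc_self s.2, dif_pos s.2⟩
  | vertex p =>
    by_cases hp : p = Γ.init e₀
    · exact key e₀ p (.inl hp)
    · obtain h | ⟨b, ⟨_, e, he, _⟩, _⟩ := (hconn p _ hp).cases_head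
      · exact absurd h hp
      · exact key e p he

/-- The oscillation of a function in `W^{1,2}` of a connected finite graph is controlled by the norm
of its gradient. -/
theorem exists_osc_bound [Finite E] (hc : ∀ e, 0 < c e) (hconn : Γ.Connected) :
    ∃ C, 0 < C ∧ ∀ (f : Γ.Space → ℝ) (v : Γ.L2 c), Γ.HasGrad c f v →
      ∀ x y, |f x - f y| ≤ C * ‖v‖ := by
  -- Without edges, connectedness leaves at most one point.
  rcases isEmpty_or_nonempty E with hE | ⟨⟨e₀⟩⟩
  · refine ⟨1, one_pos, fun f v _ x y => ?_⟩
    have : x = y := by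
      rcases x with p | ⟨e, _⟩
      · rcases y with q | ⟨e, _⟩
        · by_contra hpq
          have hpq' : p ≠ q := fun h => hpq (by rw [h])
          obtain h | ⟨b, ⟨_, e, _⟩, _⟩ := (hconn p q hpq').cases_head
          · exact hpq' h
          · exact (IsEmpty.false e).elim
        · exact (IsEmpty.false e).elim
      · exact (IsEmpty.false e).elim
    simp [this]
  · have := Fintype.ofFinite E
    choose K hK hKb using fun e => exists_edge_bound (Γ := Γ) hc e
    choose N hN hNb using fun e => exists_vertex_bound hc hconn (Γ.init e) (Γ.init e₀)
    set S := ∑ e, (K e + N e) with hS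
    have hbase : ∀ (f : Γ.Space → ℝ) (v : Γ.L2 c), Γ.HasGrad c f v →
        ∀ x, |f x - f (.vertex (Γ.init e₀))| ≤ S * ‖v‖ := fun f v hf x => by
      obtain ⟨e, s, hs, rfl⟩ := exists_par_eq hconn e₀ x
      have h1 := hKb e f v hf s hs
      have h2 := hNb e f v hf
      have h3 : K e + N e ≤ S := Finset.single_le_sum (f := fun e => K e + N e)
        (fun e _ => add_nonneg (hK e) (hN e)) (Finset.mem_univ e)
      calc _ ≤ _ := abs_sub_le _ (f (.vertex (Γ.init e))) _
        _ ≤ (K e + N e) * ‖v‖ := by rw [add_mul]; exact add_le_add h1 h2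
        _ ≤ _ := mul_le_mul_of_nonneg_right h3 (norm_nonneg v)
    have hS0 : 0 ≤ S := Finset.sum_nonneg fun e _ => add_nonneg (hK e) (hN e)
    -- Both points are compared with one base vertex; the `1` makes the constant strictly positive.
    refine ⟨S + S + 1, by positivity, fun f v hf x y => ?_⟩
    have h1 := abs_le.1 (hbase f v hf x)
    have h2 := abs_le.1 (hbase f v hf y)
    have h3 := norm_nonneg v
    rw [abs_le]
    constructor <;> linarith [h1.1, h1.2, h2.1, h2.2]

end MetricGraph

/-! ### The heat equation: maximum principle and energy decay -/

/-- A `C²` convex function with bounded second derivative which vanishes exactly on `(-∞, 0]`. -/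
theorem exists_convex_cutoff : ∃ φ Φ : ℝ → ℝ, ContDiff ℝ 1 φ ∧ (∀ x, 0 ≤ deriv φ x) ∧
    (∀ x, |deriv φ x| ≤ 1) ∧ (∀ x, |φ x| ≤ |x|) ∧ Continuous Φ ∧ (∀ x, 0 ≤ Φ x) ∧
    (∀ x, Φ x = 0 ↔ x ≤ 0) ∧ ∀ a b, |Φ b - Φ a - φ a * (b - a)| ≤ (b - a) ^ 2 := by
  -- `ψ` is the future second derivative: zero on the negative axis, positive on the positive one,
  -- at most one. Two integrations give `φ` and `Φ`.
  let ψ : ℝ → ℝ := fun s => max 0 (min s 1)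
  have hψ : Continuous ψ := by fun_prop
  have hψ0 : ∀ s, 0 ≤ ψ s := fun s => le_max_left _ _
  have hψ1 : ∀ s, |ψ s| ≤ 1 := fun s => by
    rw [abs_of_nonneg (hψ0 s)]
    exact max_le zero_le_one (min_le_right _ _)
  have hψn : ∀ s ≤ 0, ψ s = 0 := fun s hs => max_eq_left ((min_le_left _ _).trans hs)
  have hψp : ∀ s, 0 < s → 0 < ψ s := fun s hs => lt_max_of_lt_right (lt_min hs one_pos)
  have aux0 : ∀ g : ℝ → ℝ, (∀ s ≤ 0, g s = 0) → ∀ x ≤ 0, ∫ s in (0 : ℝ)..x, g s = 0 :=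
    fun g hg x hx => by
      rw [intervalIntegral.integral_congr (g := fun _ => 0)]
      · simp
      · intro s hs
        rw [uIcc_of_ge hx] at hs
        exact hg s hs.2
  have auxp : ∀ g : ℝ → ℝ, Continuous g → (∀ s, 0 < s → 0 < g s) → ∀ x, 0 < x →
      0 < ∫ s in (0 : ℝ)..x, g s := fun g hg hp x hx =>
    intervalIntegral.intervalIntegral_pos_of_pos_on (hg.intervalIntegrable _ _)
      (fun s hs => hp s hs.1) hx
  let φ : ℝ → ℝ := fun x => ∫ s in (0 : ℝ)..x, ψ s
  have hφ' : ∀ x, HasDerivAt φ (ψ x) x := fun x => (hψ.integral_hasStrictDerivAt 0 x).hasDerivAt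
  have hdφ : deriv φ = ψ := funext fun x => (hφ' x).deriv
  have hφ : Continuous φ := continuous_iff_continuousAt.2 fun x => (hφ' x).continuousAt
  have hφlip : ∀ a b, |φ b - φ a| ≤ |b - a| := fun a b => by
    have := convex_univ.norm_image_sub_le_of_norm_hasDerivWithin_le (f := φ) (C := 1)
      (fun x _ => (hφ' x).hasDerivWithinAt) (fun x _ => hψ1 x) (mem_univ a) (mem_univ b)
    simpa using this
  have hφn : ∀ x ≤ 0, φ x = 0 := aux0 ψ hψn
  have hφp : ∀ x, 0 < x → 0 < φ x := auxp ψ hψ hψp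
  let Φ : ℝ → ℝ := fun x => ∫ s in (0 : ℝ)..x, φ s
  have hΦ' : ∀ x, HasDerivAt Φ (φ x) x := fun x => (hφ.integral_hasStrictDerivAt 0 x).hasDerivAt
  have hΦn : ∀ x ≤ 0, Φ x = 0 := aux0 φ hφn
  have hΦp : ∀ x, 0 < x → 0 < Φ x := auxp φ hφ hφp
  refine ⟨φ, Φ, ?_, fun x => hdφ ▸ hψ0 x, fun x => hdφ ▸ hψ1 x, fun x => ?_,
    continuous_iff_continuousAt.2 fun x => (hΦ' x).continuousAt, fun x => ?_, fun x => ?_,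
    fun a b => ?_⟩
  · rw [contDiff_one_iff_deriv, hdφ]
    exact ⟨fun x => (hφ' x).differentiableAt, hψ⟩
  · simpa [hφn 0 le_rfl] using hφlip 0 x
  · rcases le_or_gt x 0 with h | h
    · exact (hΦn x h).ge
    · exact (hΦp x h).le
  · exact ⟨fun h => not_lt.1 fun h' => (hΦp x h').ne' h, hΦn x⟩
  -- Mean value inequality for `Φ x - φ a * x`, whose derivative `φ x - φ a` is at most `|b - a|`
  -- since `φ` is 1-Lipschitz.
  · have := (convex_uIcc a b).norm_image_sub_le_of_norm_hasDerivWithin_le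
      (f := fun x => Φ x - φ a * x) (f' := fun x => φ x - φ a * 1) (C := |b - a|)
      (fun x _ => ((hΦ' x).sub ((hasDerivAt_id x).const_mul (φ a))).hasDerivWithinAt)
      (fun x hx => by
        rw [mul_one, Real.norm_eq_abs]
        refine (hφlip a x).trans ?_
        rcases le_total a b with h | h
        · rw [uIcc_of_le h] at hx
          rw [abs_of_nonneg (by linarith [hx.1]), abs_of_nonneg (by linarith)]
          linarith [hx.2]
        · rw [uIcc_of_ge h] at hx
          rw [abs_of_nonpos (by linarith [hx.2]), abs_of_nonpos (by linarith)]
          linarith [hx.1])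
      left_mem_uIcc right_mem_uIcc
    rw [Real.norm_eq_abs, Real.norm_eq_abs, ← sq, sq_abs] at this
    convert! this using 2
    ring

namespace MetricGraph

variable {V E : Type*} {Γ : MetricGraph V E} {c : E → ℝ}

theorem HasGrad.exists_bound [Finite E] (hc : ∀ e, 0 < c e) (hconn : Γ.Connected)
    {f : Γ.Space → ℝ} {v : Γ.L2 c} (h : Γ.HasGrad c f v) : ∃ B, ∀ x, |f x| ≤ B := by
  obtain ⟨C, _, hC⟩ := exists_osc_bound hc hconn
  rcases isEmpty_or_nonempty Γ.Space with _ | ⟨⟨y⟩⟩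
  · exact ⟨0, fun x => (IsEmpty.false x).elim⟩
  · refine ⟨C * ‖v‖ + |f y|, fun x => ?_⟩
    calc |f x| = |f x - f y + f y| := by rw [sub_add_cancel]
      _ ≤ |f x - f y| + |f y| := abs_add_le _ _
      _ ≤ _ := by gcongr; exact hC f v h x y

theorem HasGrad.memLp [Finite E] (hc : ∀ e, 0 < c e) (hconn : Γ.Connected)
    {f : Γ.Space → ℝ} {v : Γ.L2 c} (h : Γ.HasGrad c f v) : MemLp f 2 (Γ.measure c) := by
  obtain ⟨B, hB⟩ := h.exists_bound hc hconn
  exact MemLp.of_bound h.1.aestronglyMeasurable B (.of_forall hB)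

theorem HasAdjGrad.inner_eq {v G : Γ.L2 c} (h : Γ.HasAdjGrad c v (-G)) {f : Γ.Space → ℝ}
    {w F : Γ.L2 c} (hf : Γ.HasGrad c f w) (hF : F =ᵐ[Γ.measure c] f) :
    inner ℝ v w = -inner ℝ G F := by
  rw [h f w hf, L2.inner_def, ← integral_neg]
  refine integral_congr_ae ?_
  filter_upwards [Lp.coeFn_neg G, hF] with x hx hx'
  simp only [hx, hx', Pi.neg_apply, RCLike.inner_apply, conj_trivial]
  ring

/-- Functions of finite energy are bounded, so each has an `L²` class, and the adjoint relation
becomes an identity between inner products that is visibly linear in `(v, G)`. -/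
theorem hasAdjGrad_neg_iff [Finite E] (hc : ∀ e, 0 < c e) (hconn : Γ.Connected) {v G : Γ.L2 c} :
    Γ.HasAdjGrad c v (-G) ↔ ∀ (f : Γ.Space → ℝ) (w F : Γ.L2 c), Γ.HasGrad c f w →
      F =ᵐ[Γ.measure c] f → inner ℝ v w = -inner ℝ G F := by
  refine ⟨fun h f w F hf hF => h.inner_eq hf hF, fun h f w hf => ?_⟩
  have hm := hf.memLp hc hconn
  rw [h f w (hm.toLp f) hf hm.coeFn_toLp, L2.inner_def, ← integral_neg]
  refine integral_congr_ae ?_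
  filter_upwards [Lp.coeFn_neg G, hm.coeFn_toLp] with x hx hx'
  simp only [hx, hx', Pi.neg_apply, RCLike.inner_apply, conj_trivial]
  ring

theorem HasLaplacian.sub [Finite E] (hc : ∀ e, 0 < c e) (hconn : Γ.Connected) {F F' G G' : Γ.L2 c}
    (h : Γ.HasLaplacian c F G) (h' : Γ.HasLaplacian c F' G') :
    Γ.HasLaplacian c (F - F') (G - G') := by
  obtain ⟨f, v, hF, hf, hv⟩ := h
  obtain ⟨f', v', hF', hf', hv'⟩ := h'
  refine ⟨_, _, ?_, hf.sub hc hf', ?_⟩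
  · filter_upwards [Lp.coeFn_sub F F', hF, hF'] with x h1 h2 h3
    rw [h1, Pi.sub_apply, h2, h3]
  · refine (hasAdjGrad_neg_iff hc hconn).2 fun f w F hf hF => ?_
    rw [inner_sub_left, inner_sub_left, hv.inner_eq hf hF, hv'.inner_eq hf hF]
    ring

theorem IsHeatSolution.hasDerivAt {w₀ : Γ.Space → ℝ} {W : ℝ → Γ.L2 c}
    (h : Γ.IsHeatSolution c w₀ W) {t : ℝ} (ht : 0 < t) : HasDerivAt W (deriv W t) t :=
  ((h.contDiffOn.differentiableOn one_ne_zero).differentiableAt (Ioi_mem_nhds ht)).hasDerivAt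

theorem IsHeatSolution.sub [Finite E] (hc : ∀ e, 0 < c e) (hconn : Γ.Connected)
    {w₀ w₀' : Γ.Space → ℝ} {W W' : ℝ → Γ.L2 c} (h : Γ.IsHeatSolution c w₀ W)
    (h' : Γ.IsHeatSolution c w₀' W') :
    Γ.IsHeatSolution c (fun x => w₀ x - w₀' x) fun t => W t - W' t where
  initial := by
    filter_upwards [Lp.coeFn_sub (W 0) (W' 0), h.initial, h'.initial] with x h1 h2 h3
    rw [h1, Pi.sub_apply, h2, h3]
  continuousOn := h.continuousOn.sub h'.continuousOn
  contDiffOn := h.contDiffOn.sub h'.contDiffOn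
  heat t ht := by
    rw [((h.hasDerivAt ht).fun_sub (h'.hasDerivAt ht)).deriv]
    exact (h.heat t ht).sub hc hconn (h'.heat t ht)

theorem isHeatSolution_zero [Finite E] (hc : ∀ e, 0 < c e) (hconn : Γ.Connected) :
    Γ.IsHeatSolution c (fun _ => 0) fun _ => 0 where
  initial := Lp.coeFn_zero ℝ 2 (Γ.measure c)
  continuousOn := continuousOn_const
  contDiffOn := contDiffOn_const
  heat t _ := by
    rw [deriv_const]
    refine ⟨_, _, Lp.coeFn_zero ℝ 2 (Γ.measure c), hasGrad_zero hc, ?_⟩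
    refine (hasAdjGrad_neg_iff hc hconn).2 fun f w F hf hF => ?_
    rw [inner_zero_left, inner_zero_left, neg_zero]

section Comparison

variable {α : Type*} {m : MeasurableSpace α} {μ : Measure α} [IsFiniteMeasure μ]

theorem memLp_comp_sub_const {φ : ℝ → ℝ} (hφ : Continuous φ) (hb : ∀ x, |φ x| ≤ |x|) (M : ℝ)
    (F : Lp ℝ 2 μ) : MemLp (fun x => φ (F x - M)) 2 μ :=
  ((Lp.memLp F).sub (memLp_const M)).mono
    (hφ.comp_aestronglyMeasurable ((Lp.aestronglyMeasurable F).sub aestronglyMeasurable_const))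
    (.of_forall fun _ => hb _)

theorem integrable_comp_sub_const {Φ : ℝ → ℝ} (hΦ : Continuous Φ) (hb : ∀ x, |Φ x| ≤ x ^ 2) (M : ℝ)
    (F : Lp ℝ 2 μ) : Integrable (fun x => Φ (F x - M)) μ :=
  ((Lp.memLp F).sub (memLp_const M)).integrable_sq.mono
    (hΦ.comp_aestronglyMeasurable ((Lp.aestronglyMeasurable F).sub aestronglyMeasurable_const))
    (.of_forall fun _ => (hb _).trans (le_abs_self _))

/-- The pointwise Taylor remainder is at most `(F' - F)²`, whose integral is exactly `‖F' - F‖²`;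
the remainder is thus quadratic in the `L²` norm. -/
theorem hasFDerivAt_integral_comp_sub_const {φ Φ : ℝ → ℝ} (hφ : Continuous φ)
    (hb : ∀ x, |φ x| ≤ |x|) (hΦ : Continuous Φ) (hB : ∀ x, |Φ x| ≤ x ^ 2)
    (hT : ∀ a b, |Φ b - Φ a - φ a * (b - a)| ≤ (b - a) ^ 2) (M : ℝ) (F : Lp ℝ 2 μ) :
    HasFDerivAt (fun F : Lp ℝ 2 μ => ∫ x, Φ (F x - M) ∂μ)
      (innerSL ℝ ((memLp_comp_sub_const hφ hb M F).toLp _)) F := by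
  set P := (memLp_comp_sub_const hφ hb M F).toLp _ with hP
  refine .of_isLittleO (Asymptotics.IsBigO.trans_isLittleO (.of_bound 1 (.of_forall fun F' => ?_))
    (Asymptotics.isLittleO_pow_sub_sub F (m := 2) one_lt_two))
  have hi := integrable_comp_sub_const hΦ hB M F
  have hi' := integrable_comp_sub_const hΦ hB M F'
  have hP' := (memLp_comp_sub_const hφ hb M F).coeFn_toLp
  have hin : Integrable (fun x => inner ℝ (P x) ((F' - F : Lp ℝ 2 μ) x)) μ :=
    L2.integrable_inner P (F' - F)
  have hd : Integrable (fun x => Φ (F' x - M) - Φ (F x - M)) μ := hi'.sub hi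
  rw [innerSL_apply_apply, L2.inner_def, ← integral_sub hi' hi, ← integral_sub hd hin,
    norm_pow, norm_norm, one_mul, ← real_inner_self_eq_norm_sq, L2.inner_def]
  refine norm_integral_le_of_norm_le (L2.integrable_inner _ _) ?_
  filter_upwards [hP', Lp.coeFn_sub F' F] with x h1 h2
  rw [hP, h1, h2]
  have := hT (F x - M) (F' x - M)
  simp only [sub_sub_sub_cancel_right] at this
  simp only [Pi.sub_apply, RCLike.inner_apply, conj_trivial, Real.norm_eq_abs]
  rw [mul_comm _ (φ _), ← sq]
  exact this

end Comparison

/-- The maximum principle for the heat equation. -/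
theorem IsHeatSolution.le_of_initial_le [Finite E] (hc : ∀ e, 0 < c e)
    {w₀ : Γ.Space → ℝ} {W : ℝ → Γ.L2 c} (h : Γ.IsHeatSolution c w₀ W) {M : ℝ}
    (hM : ∀ x, w₀ x ≤ M) {t : ℝ} (ht : 0 ≤ t) : ∀ᵐ x ∂Γ.measure c, W t x ≤ M := by
  obtain ⟨φ, Φ, hφ, hφ0, hφ1, hφb, hΦ, hΦ0, hΦz, hT⟩ := exists_convex_cutoff
  have hΦ00 : Φ 0 = 0 := (hΦz 0).2 le_rfl
  have hφ00 : φ 0 = 0 := by simpa using hφb 0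
  have hΦb : ∀ x, |Φ x| ≤ x ^ 2 := fun x => by simpa [hΦ00, hφ00] using hT 0 x
  have hZ := hasFDerivAt_integral_comp_sub_const (μ := Γ.measure c) hφ.continuous hφb hΦ hΦb hT M
  have hZ' : ∀ t, 0 < t → HasDerivAt (fun t => ∫ x, Φ (W t x - M) ∂Γ.measure c) _ t := fun t ht =>
    (hZ (W t)).comp_hasDerivAt t (h.hasDerivAt ht)
  -- The derivative is `⟨φ(W - M), W_t⟩ = -⟨d W, d φ(W - M)⟩ = -∫ φ'(W - M) |d W|² ≤ 0`. The
  -- integral starts at zero, so it stays zero, and `Φ` vanishes only on `(-∞, 0]`.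
  have hanti : AntitoneOn (fun t => ∫ x, Φ (W t x - M) ∂Γ.measure c) (Ici 0) := by
    refine antitoneOn_of_deriv_nonpos (convex_Ici 0) ?_ ?_ ?_
    · exact (continuous_iff_continuousAt.2 fun F => (hZ F).continuousAt).comp_continuousOn
        h.continuousOn
    · rw [interior_Ici]
      exact fun s hs => (hZ' s hs).differentiableAt.differentiableWithinAt
    · rw [interior_Ici]
      intro s hs
      rw [(hZ' s hs).deriv, innerSL_apply_apply]
      obtain ⟨f, v, hF, hf, hv⟩ := h.heat s hs
      have hd : ∀ y, HasDerivAt (fun y => φ (y - M)) (deriv φ (y - M)) y := fun y =>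
        (hφ.differentiable one_ne_zero _).hasDerivAt.comp_sub_const y M
      obtain ⟨v', hv', hg⟩ := hf.comp hc (φ := fun y => φ (y - M))
        (hφ.comp (contDiff_id.sub contDiff_const)) (B := 1) fun x => by
          rw [(hd _).deriv]; exact hφ1 _
      have key := hv.inner_eq (F := (memLp_comp_sub_const hφ.continuous hφb M (W s)).toLp _) hg <| by
        filter_upwards [(memLp_comp_sub_const hφ.continuous hφb M (W s)).coeFn_toLp, hF]
          with x h1 h2
        rw [h1, h2]
      rw [real_inner_comm, ← neg_nonneg, ← key, L2.inner_def]
      refine integral_nonneg_of_ae ?_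
      filter_upwards [hv'] with x hx
      rw [hx, (hd _).deriv]
      simp only [Pi.zero_apply, RCLike.inner_apply, conj_trivial]
      rw [mul_assoc]
      exact mul_nonneg (hφ0 _) (mul_self_nonneg _)
  have h0 : ∫ x, Φ (W 0 x - M) ∂Γ.measure c = 0 := by
    refine integral_eq_zero_of_ae ?_
    filter_upwards [h.initial] with x hx
    exact (hΦz _).2 (by rw [hx]; linarith [hM x])
  have h1 : ∫ x, Φ (W t x - M) ∂Γ.measure c = 0 :=
    le_antisymm ((hanti (mem_Ici.2 le_rfl) ht ht).trans_eq h0) (integral_nonneg fun x => hΦ0 _)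
  filter_upwards [(integral_eq_zero_iff_of_nonneg (fun x => hΦ0 _)
    (integrable_comp_sub_const hΦ hΦb M (W t))).1 h1] with x hx
  linarith [(hΦz _).1 hx]

/-- This is the upper bound applied to `-W`, written as the zero solution minus `W`. -/
theorem IsHeatSolution.ge_of_initial_ge [Finite E] (hc : ∀ e, 0 < c e) (hconn : Γ.Connected)
    {w₀ : Γ.Space → ℝ} {W : ℝ → Γ.L2 c} (h : Γ.IsHeatSolution c w₀ W) {M : ℝ}
    (hM : ∀ x, M ≤ w₀ x) {t : ℝ} (ht : 0 ≤ t) : ∀ᵐ x ∂Γ.measure c, M ≤ W t x := by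
  have h1 := ((isHeatSolution_zero hc hconn).sub hc hconn h).le_of_initial_le hc (M := -M)
    (fun x => by linarith [hM x]) ht
  filter_upwards [h1, Lp.coeFn_neg (W t)] with x hx hx'
  rw [zero_sub, hx', Pi.neg_apply] at hx
  linarith

/-- The energy of a solution of the heat equation is at most its initial energy. -/
theorem IsHeatSolution.norm_grad_le [Finite E] (hc : ∀ e, 0 < c e)
    {w₀ : Γ.Space → ℝ} {W : ℝ → Γ.L2 c} (h : Γ.IsHeatSolution c w₀ W) {v₀ : Γ.L2 c}
    (hv₀ : Γ.HasGrad c w₀ v₀) {t : ℝ} (ht : 0 < t) {f : Γ.Space → ℝ} {v : Γ.L2 c}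
    (hf : W t =ᵐ[Γ.measure c] f) (hv : Γ.HasGrad c f v) : ‖v‖ ≤ ‖v₀‖ := by
  have hex : ∀ t, ∃ (f : Γ.Space → ℝ) (v : Γ.L2 c), 0 < t → W t =ᵐ[Γ.measure c] f ∧
      Γ.HasGrad c f v ∧ Γ.HasAdjGrad c v (-deriv W t) := fun t => by
    by_cases ht : 0 < t
    · obtain ⟨f, v, h⟩ := h.heat t ht
      exact ⟨f, v, fun _ => h⟩
    · exact ⟨0, 0, fun h => absurd h ht⟩
  choose k p hkp using hex
  have hcont : ContinuousOn (deriv W) (Ioi 0) :=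
    h.contDiffOn.continuousOn_deriv_of_isOpen isOpen_Ioi le_rfl
  have hcoe : ∀ s t, 0 < s → 0 < t → (W s - W t : Γ.L2 c) =ᵐ[Γ.measure c] fun x => k s x - k t x :=
    fun s t hs ht => by
      filter_upwards [Lp.coeFn_sub (W s) (W t), (hkp s hs).1, (hkp t ht).1] with x h1 h2 h3
      rw [h1, Pi.sub_apply, h2, h3]
  -- Testing the equations at `s` and at `t` with `W s - W t` and adding, the mixed terms cancel by
  -- symmetry. The energy can therefore be differentiated without differentiating the gradient in
  -- time.
  have hdiff : ∀ s t, 0 < s → 0 < t →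
      ‖p s‖ ^ 2 - ‖p t‖ ^ 2 = -inner ℝ (deriv W s + deriv W t) (W s - W t) := fun s t hs ht => by
    have hg := (hkp s hs).2.1.sub hc (hkp t ht).2.1
    have h1 := (hkp s hs).2.2.inner_eq hg (hcoe s t hs ht)
    have h2 := (hkp t ht).2.2.inner_eq hg (hcoe s t hs ht)
    rw [inner_add_left, neg_add, ← h1, ← h2, inner_sub_right, inner_sub_right,
      real_inner_self_eq_norm_sq, real_inner_self_eq_norm_sq, real_inner_comm]
    ring
  have hderiv : ∀ t, 0 < t →
      HasDerivAt (fun s => ‖p s‖ ^ 2) (-inner ℝ (deriv W t + deriv W t) (deriv W t)) t := by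
    intro t ht
    rw [hasDerivAt_iff_tendsto_slope]
    have h1 := hasDerivAt_iff_tendsto_slope.1 (h.hasDerivAt ht)
    have h2 : Filter.Tendsto (deriv W) (nhdsWithin t {t}ᶜ) (nhds (deriv W t)) :=
      (hcont.continuousAt (Ioi_mem_nhds ht)).tendsto.mono_left nhdsWithin_le_nhds
    refine ((h2.add_const (deriv W t)).inner h1).neg.congr' ?_
    filter_upwards [nhdsWithin_le_nhds (Ioi_mem_nhds ht)] with s hs
    simp only [slope, vsub_eq_sub, inner_smul_right, hdiff s t hs ht, smul_eq_mul]
    ring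
  have hanti : AntitoneOn (fun s => ‖p s‖ ^ 2) (Ioi 0) := by
    refine antitoneOn_of_deriv_nonpos (convex_Ioi 0)
      (fun s hs => (hderiv s hs).continuousAt.continuousWithinAt) ?_ ?_
    · rw [interior_Ioi]
      exact fun s hs => (hderiv s hs).differentiableAt.differentiableWithinAt
    · rw [interior_Ioi]
      intro s hs
      rw [(hderiv s hs).deriv, inner_add_left, real_inner_self_eq_norm_sq]
      nlinarith [sq_nonneg ‖deriv W s‖]
  have hvp : v = p t := by
    refine hv.unique hc ((hkp t ht).2.1.congr hc hv.1 ?_)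
    exact (hkp t ht).1.symm.trans hf
  subst hvp
  by_contra! hlt
  have hlt2 : ‖v₀‖ ^ 2 < ‖p t‖ ^ 2 := pow_lt_pow_left₀ hlt (norm_nonneg _) two_ne_zero
  -- At time zero only `L²` continuity of `W` is available, so the initial energy is reached
  -- indirectly. Testing with `W s - W 0` and using `2⟨p s, v₀⟩ ≤ ‖p s‖² + ‖v₀‖²` bounds `‖p s‖²`
  -- plus the derivative of `‖W s - W 0‖²`.
  have hinit : ∀ s, 0 < s → ‖p s‖ ^ 2 + 2 * inner ℝ (W s - W 0) (deriv W s) ≤ ‖v₀‖ ^ 2 :=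
    fun s hs => by
      have hg := (hkp s hs).2.1.sub hc hv₀
      have h1 := (hkp s hs).2.2.inner_eq (F := W s - W 0) hg <| by
        filter_upwards [Lp.coeFn_sub (W s) (W 0), (hkp s hs).1, h.initial] with x h1 h2 h3
        rw [h1, Pi.sub_apply, h2, h3]
      have h2 := norm_sub_sq_real v₀ (p s)
      rw [inner_sub_right, real_inner_self_eq_norm_sq] at h1
      rw [real_inner_comm (p s), real_inner_comm (deriv W s)] at *
      nlinarith [sq_nonneg ‖v₀ - p s‖]
  have hd : ∀ s, 0 < s →
      HasDerivAt (fun s => ‖W s - W 0‖ ^ 2) (2 * inner ℝ (W s - W 0) (deriv W s)) s :=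
    fun s hs => ((h.hasDerivAt hs).sub_const (W 0)).norm_sq
  -- If the energy at `t` exceeded `‖v₀‖²`, so would all earlier ones, and `‖W s - W 0‖²` would
  -- strictly decrease from its value zero.
  have hstrict : StrictAntiOn (fun s => ‖W s - W 0‖ ^ 2) (Icc 0 t) := by
    refine strictAntiOn_of_deriv_neg (convex_Icc 0 t) ?_ ?_
    · exact ((h.continuousOn.mono Icc_subset_Ici_self).sub continuousOn_const).norm.pow 2
    · rw [interior_Icc]
      intro s hs
      rw [(hd s hs.1).deriv]
      have h1 := hinit s hs.1
      have h2 : ‖p t‖ ^ 2 ≤ ‖p s‖ ^ 2 := hanti hs.1 ht hs.2.le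
      linarith
  have := hstrict ⟨le_rfl, ht.le⟩ ⟨ht.le, le_rfl⟩ ht
  simp only [sub_self, norm_zero] at this
  nlinarith [sq_nonneg ‖W t - W 0‖]

end MetricGraph

/-! ### Estimates for Cole–Hopf solutions -/

theorem norm_le_of_ae_abs_le_add {α : Type*} {m : MeasurableSpace α} {μ : Measure α}
    {f g h : Lp ℝ 2 μ} {a b : ℝ} (ha : 0 ≤ a) (hb : 0 ≤ b)
    (H : ∀ᵐ x ∂μ, |f x| ≤ a * |g x| + b * |h x|) : ‖f‖ ≤ a * ‖g‖ + b * ‖h‖ := by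
  have h1 : ‖f‖ ≤ ‖a • |g| + b • |h|‖ := by
    refine Lp.norm_le_norm_of_ae_le ?_
    filter_upwards [H, Lp.coeFn_add (a • |g|) (b • |h|), Lp.coeFn_smul a |g|, Lp.coeFn_smul b |h|,
      Lp.coeFn_abs g, Lp.coeFn_abs h] with x hx h1 h2 h3 h4 h5
    rw [h1, Pi.add_apply, h2, h3, Pi.smul_apply, Pi.smul_apply, h4, h5]
    exact hx.trans (le_abs_self _)
  refine h1.trans ((norm_add_le _ _).trans_eq ?_)
  rw [norm_smul, norm_smul, norm_abs_eq_norm, norm_abs_eq_norm, Real.norm_of_nonneg ha,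
    Real.norm_of_nonneg hb]

theorem abs_exp_sub_exp_le {p q S : ℝ} (hp : p ≤ S) (hq : q ≤ S) :
    |Real.exp p - Real.exp q| ≤ Real.exp S * |p - q| := by
  have aux : ∀ p q : ℝ, p ≤ S → Real.exp p - Real.exp q ≤ Real.exp S * |p - q| := fun p q hp => by
    have h1 := Real.add_one_le_exp (q - p)
    have h2 : Real.exp q = Real.exp p * Real.exp (q - p) := by rw [← Real.exp_add]; ring_nf
    calc Real.exp p - Real.exp q ≤ Real.exp p * (p - q) := by
          rw [h2]; nlinarith [Real.exp_pos p]
      _ ≤ Real.exp p * |p - q| := by gcongr; exact le_abs_self _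
      _ ≤ _ := by gcongr
  refine abs_sub_le_iff.2 ⟨aux p q hp, ?_⟩
  rw [abs_sub_comm]
  exact aux q p hq

namespace MetricGraph

variable {V E : Type*} {Γ : MetricGraph V E} {c : E → ℝ}

theorem HasGrad.exp_neg_half [Finite E] (hc : ∀ e, 0 < c e) (hconn : Γ.Connected)
    {g : Γ.Space → ℝ} {u : Γ.L2 c} (h : Γ.HasGrad c g u) :
    ∃ v : Γ.L2 c, (v =ᵐ[Γ.measure c] fun x => -(1 / 2) * Real.exp (-g x / 2) * u x) ∧
      Γ.HasGrad c (fun x => Real.exp (-g x / 2)) v := by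
  obtain ⟨B, hB⟩ := h.exists_bound hc hconn
  have hd : ∀ y : ℝ, deriv (fun y : ℝ => Real.exp (-y / 2)) y = -(1 / 2) * Real.exp (-y / 2) :=
    fun y => (((hasDerivAt_id y).neg.div_const 2).exp.congr_deriv (by simp; ring)).deriv
  obtain ⟨v, hv, hg⟩ := h.comp hc (φ := fun y => Real.exp (-y / 2))
    (contDiff_id.neg.div_const 2).exp (B := Real.exp (B / 2)) fun x => by
      rw [hd, abs_mul, Real.abs_exp]
      have h1 : Real.exp (-g x / 2) ≤ Real.exp (B / 2) :=
        Real.exp_le_exp.2 (by linarith [(abs_le.1 (hB x)).1])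
      norm_num
      linarith [Real.exp_pos (-g x / 2)]
  refine ⟨v, ?_, hg⟩
  filter_upwards [hv] with x hx
  rw [hx, hd]

theorem exp_neg_half_bounds {y B : ℝ} (h : |y| ≤ B) :
    Real.exp (-(B / 2)) ≤ Real.exp (-y / 2) ∧ Real.exp (-y / 2) ≤ Real.exp (B / 2) :=
  ⟨Real.exp_le_exp.2 (by linarith [(abs_le.1 h).2]),
    Real.exp_le_exp.2 (by linarith [(abs_le.1 h).1])⟩

/-- The relation `d w = - w u / 2` for `u = - 2 d log w`. -/
theorem IsHeatSolution.hasGrad_of_log [Finite E] (hc : ∀ e, 0 < c e) (hconn : Γ.Connected)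
    {h₀ : Γ.Space → ℝ} {B : ℝ} (hB : ∀ x, |h₀ x| ≤ B) {W : ℝ → Γ.L2 c}
    (hW : Γ.IsHeatSolution c (fun x => Real.exp (-h₀ x / 2)) W) {t : ℝ} (ht : 0 < t)
    {w : Γ.Space → ℝ} (hw : Continuous w) (hWw : W t =ᵐ[Γ.measure c] w) {u : Γ.L2 c}
    (hu : Γ.HasGrad c (fun x => -2 * Real.log (w x)) u) :
    (∀ᵐ x ∂Γ.measure c, Real.exp (-(B / 2)) ≤ w x) ∧ ∃ v : Γ.L2 c, Γ.HasGrad c w v ∧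
      ∀ᵐ x ∂Γ.measure c, v x = -(1 / 2) * w x * u x := by
  have hlow : ∀ᵐ x ∂Γ.measure c, Real.exp (-(B / 2)) ≤ w x := by
    filter_upwards [hW.ge_of_initial_ge hc hconn (fun x => (exp_neg_half_bounds (hB x)).1) ht.le,
      hWw] with x h1 h2
    rwa [h2] at h1
  -- The chain rule is applied to the exponential of the finite-energy function `-2 log w`, not to
  -- the logarithm. It returns `w` wherever `w > 0`, which the maximum principle gives almost
  -- everywhere.
  have hexp : ∀ᵐ x ∂Γ.measure c, Real.exp (-(-2 * Real.log (w x)) / 2) = w x := by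
    filter_upwards [hlow] with x hx
    rw [show -(-2 * Real.log (w x)) / 2 = Real.log (w x) by ring,
      Real.exp_log ((Real.exp_pos _).trans_le hx)]
  obtain ⟨v, hv, hg⟩ := hu.exp_neg_half hc hconn
  refine ⟨hlow, v, hg.congr hc hw hexp, ?_⟩
  filter_upwards [hv, hexp] with x h1 h2
  rw [h1, h2]

theorem norm_gradient_exp_le {h₀ : Γ.Space → ℝ} {B : ℝ} (hB : ∀ x, |h₀ x| ≤ B) {u v : Γ.L2 c}
    (hv : v =ᵐ[Γ.measure c] fun x => -(1 / 2) * Real.exp (-h₀ x / 2) * u x) :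
    ‖v‖ ≤ 1 / 2 * Real.exp (B / 2) * ‖u‖ := by
  refine Lp.norm_le_mul_norm_of_ae_le_mul ?_
  filter_upwards [hv] with x hx
  rw [hx, norm_mul, norm_mul, Real.norm_eq_abs (Real.exp _), Real.abs_exp]
  have := (exp_neg_half_bounds (hB x)).2
  norm_num
  gcongr

/-- One factor `e^{B/2}` comes from dividing by `w(t)`, the other from differentiating `e^{-h₀/2}`.
-/
theorem norm_coleHopf_le [Finite E] (hc : ∀ e, 0 < c e) (hconn : Γ.Connected)
    {h₀ : Γ.Space → ℝ} {u₀ : Γ.L2 c} {u : ℝ → Γ.L2 c} {B : ℝ} (hB : ∀ x, |h₀ x| ≤ B)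
    (hu₀ : Γ.HasGrad c h₀ u₀) (hu : Γ.IsColeHopfSolution c h₀ u) {t : ℝ} (ht : 0 < t) :
    ‖u t‖ ≤ ‖u₀‖ * Real.exp B := by
  obtain ⟨W, hW, hWu⟩ := hu
  obtain ⟨w, hw, hWw, hut⟩ := hWu t ht.le
  obtain ⟨hlow, v, hv, hvw⟩ := hW.hasGrad_of_log hc hconn hB ht hw hWw hut
  obtain ⟨v₀, hv₀, hg₀⟩ := hu₀.exp_neg_half hc hconn
  have h1 := hW.norm_grad_le hc hg₀ ht hWw hv
  have h2 := norm_gradient_exp_le hB hv₀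
  have h3 : ‖u t‖ ≤ 2 * Real.exp (B / 2) * ‖v‖ := by
    refine Lp.norm_le_mul_norm_of_ae_le_mul ?_
    filter_upwards [hlow, hvw] with x hx hx'
    have hpos : 0 < w x := (Real.exp_pos _).trans_le hx
    have h5 : 1 ≤ Real.exp (B / 2) * w x := by
      rw [Real.exp_neg] at hx
      exact (inv_le_iff_one_le_mul₀' (Real.exp_pos _)).1 hx
    rw [hx', norm_mul, norm_mul, Real.norm_of_nonneg hpos.le, Real.norm_eq_abs (-(1 / 2)),
      abs_neg, abs_of_pos (by norm_num : (0 : ℝ) < 1 / 2)]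
    calc ‖u t x‖ ≤ (Real.exp (B / 2) * w x) * ‖u t x‖ :=
          le_mul_of_one_le_left (norm_nonneg _) h5
      _ = _ := by ring
  calc ‖u t‖ ≤ 2 * Real.exp (B / 2) * (1 / 2 * Real.exp (B / 2) * ‖u₀‖) :=
        h3.trans (by gcongr; exact h1.trans h2)
    _ = ‖u₀‖ * (Real.exp (B / 2) * Real.exp (B / 2)) := by ring
    _ = _ := by rw [← Real.exp_add, add_halves]

/-- The identity `w' (u - u') = -(w - w') u - 2 (d w - d w')` is divided by `w' ≥ e^{-B'/2}`. Only
`u` multiplies `w - w'`, whence the asymmetry of the bound. -/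
theorem norm_coleHopf_sub_le [Finite E] (hc : ∀ e, 0 < c e) (hconn : Γ.Connected)
    {h₀ h₀' : Γ.Space → ℝ} {u₀ u₀' : Γ.L2 c} {u u' : ℝ → Γ.L2 c} {B B' D : ℝ}
    (hB : ∀ x, |h₀ x| ≤ B) (hB' : ∀ x, |h₀' x| ≤ B') (hD0 : 0 ≤ D)
    (hD : ∀ x, |h₀ x - h₀' x| ≤ D)
    (hu₀ : Γ.HasGrad c h₀ u₀) (hu : Γ.IsColeHopfSolution c h₀ u)
    (hu₀' : Γ.HasGrad c h₀' u₀') (hu' : Γ.IsColeHopfSolution c h₀' u') {t : ℝ} (ht : 0 < t) :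
    ‖u t - u' t‖ ≤ Real.exp (B' / 2) * (1 / 2 * Real.exp ((B + B') / 2) * D) * (‖u t‖ + ‖u₀‖) +
      Real.exp B' * ‖u₀ - u₀'‖ := by
  obtain ⟨W, hW, hWu⟩ := hu
  obtain ⟨w, hw, hWw, hut⟩ := hWu t ht.le
  obtain ⟨-, v, hv, hvw⟩ := hW.hasGrad_of_log hc hconn hB ht hw hWw hut
  obtain ⟨v₀, hv₀, hg₀⟩ := hu₀.exp_neg_half hc hconn
  obtain ⟨W', hW', hWu'⟩ := hu'
  obtain ⟨w', hw', hWw', hut'⟩ := hWu' t ht.le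
  obtain ⟨hlow', v', hv', hvw'⟩ := hW'.hasGrad_of_log hc hconn hB' ht hw' hWw' hut'
  obtain ⟨v₀', hv₀', hg₀'⟩ := hu₀'.exp_neg_half hc hconn
  -- Both exponents `-h₀/2` and `-h₀'/2` are at most `(B + B') / 2`, so `δ` bounds the difference of
  -- the initial data, and by the maximum principle that of `w` and `w'`.
  set δ := 1 / 2 * Real.exp ((B + B') / 2) * D with hδ
  have hδ0 : 0 ≤ δ := by positivity
  have hexp : ∀ x, |Real.exp (-h₀ x / 2) - Real.exp (-h₀' x / 2)| ≤ δ := fun x => by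
    have h1 := (abs_le.1 (hB x)).1
    have h2 := (abs_le.1 (hB' x)).1
    have hB0 := (abs_nonneg _).trans (hB x)
    have hB0' := (abs_nonneg _).trans (hB' x)
    refine (abs_exp_sub_exp_le (S := (B + B') / 2) (by linarith) (by linarith)).trans ?_
    have h3 : |-h₀ x / 2 - -h₀' x / 2| = 1 / 2 * |h₀ x - h₀' x| := by
      rw [show -h₀ x / 2 - -h₀' x / 2 = -(1 / 2) * (h₀ x - h₀' x) by ring, abs_mul]
      norm_num
    rw [h3, hδ]
    have := mul_le_mul_of_nonneg_left (hD x) (Real.exp_pos ((B + B') / 2)).le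
    linarith
  have hsol := hW.sub hc hconn hW'
  have hWww : (W t - W' t : Γ.L2 c) =ᵐ[Γ.measure c] fun x => w x - w' x := by
    filter_upwards [Lp.coeFn_sub (W t) (W' t), hWw, hWw'] with x h1 h2 h3
    rw [h1, Pi.sub_apply, h2, h3]
  have hww : ∀ᵐ x ∂Γ.measure c, |w x - w' x| ≤ δ := by
    filter_upwards [hsol.le_of_initial_le hc (fun x => (abs_le.1 (hexp x)).2) ht.le,
      hsol.ge_of_initial_ge hc hconn (fun x => (abs_le.1 (hexp x)).1) ht.le, hWww] with x h1 h2 h3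
    rw [h3] at h1 h2
    exact abs_le.2 ⟨h2, h1⟩
  have hgrad : ‖v - v'‖ ≤ ‖v₀ - v₀'‖ := hsol.norm_grad_le hc (hg₀.sub hc hg₀') ht hWww (hv.sub hc hv')
  have hinit : ‖v₀ - v₀'‖ ≤ 1 / 2 * δ * ‖u₀‖ + 1 / 2 * Real.exp (B' / 2) * ‖u₀ - u₀'‖ := by
    refine norm_le_of_ae_abs_le_add (by positivity) (by positivity) ?_
    filter_upwards [Lp.coeFn_sub v₀ v₀', Lp.coeFn_sub u₀ u₀', hv₀, hv₀'] with x h1 h2 h3 h4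
    rw [h1, h2, Pi.sub_apply, Pi.sub_apply, h3, h4]
    set p := Real.exp (-h₀ x / 2)
    set q := Real.exp (-h₀' x / 2)
    have hq : |q| ≤ Real.exp (B' / 2) := by
      rw [Real.abs_exp]
      exact (exp_neg_half_bounds (hB' x)).2
    calc |-(1 / 2) * p * u₀ x - -(1 / 2) * q * u₀' x|
        = |-(1 / 2) * (p - q) * u₀ x + -(1 / 2) * q * (u₀ x - u₀' x)| := by congr 1; ring
      _ ≤ |-(1 / 2) * (p - q) * u₀ x| + |-(1 / 2) * q * (u₀ x - u₀' x)| := abs_add_le _ _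
      _ = 1 / 2 * |p - q| * |u₀ x| + 1 / 2 * |q| * |u₀ x - u₀' x| := by
        simp only [abs_mul, abs_neg, abs_of_pos (by norm_num : (0 : ℝ) < 1 / 2)]
      _ ≤ _ := by gcongr; exact hexp x
  have hfin : ‖u t - u' t‖ ≤ Real.exp (B' / 2) * δ * ‖u t‖ + 2 * Real.exp (B' / 2) * ‖v - v'‖ := by
    refine norm_le_of_ae_abs_le_add (by positivity) (by positivity) ?_
    filter_upwards [Lp.coeFn_sub (u t) (u' t), Lp.coeFn_sub v v', hvw, hvw', hlow', hww]
      with x h1 h2 h3 h4 h5 h6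
    have hpos : 0 < w' x := (Real.exp_pos _).trans_le h5
    have h7 : 1 ≤ Real.exp (B' / 2) * w' x := by
      rw [Real.exp_neg] at h5
      exact (inv_le_iff_one_le_mul₀' (Real.exp_pos _)).1 h5
    rw [h1, h2, Pi.sub_apply, Pi.sub_apply]
    have h8 : w' x * |u t x - u' t x| ≤ δ * |u t x| + 2 * |v x - v' x| := by
      calc w' x * |u t x - u' t x| = |w' x * (u t x - u' t x)| := by
            rw [abs_mul, abs_of_pos hpos]
        _ = |-((w x - w' x) * u t x) + -2 * (v x - v' x)| := by rw [h3, h4]; congr 1; ring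
        _ ≤ |-((w x - w' x) * u t x)| + |-2 * (v x - v' x)| := abs_add_le _ _
        _ = |w x - w' x| * |u t x| + 2 * |v x - v' x| := by
          rw [abs_neg, abs_mul, abs_mul, abs_neg, abs_two]
        _ ≤ _ := by gcongr
    calc |u t x - u' t x| ≤ (Real.exp (B' / 2) * w' x) * |u t x - u' t x| :=
          le_mul_of_one_le_left (abs_nonneg _) h7
      _ = Real.exp (B' / 2) * (w' x * |u t x - u' t x|) := by ring
      _ ≤ Real.exp (B' / 2) * (δ * |u t x| + 2 * |v x - v' x|) := by gcongr
      _ = _ := by ring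
  calc ‖u t - u' t‖ ≤ Real.exp (B' / 2) * δ * ‖u t‖ + 2 * Real.exp (B' / 2) *
        (1 / 2 * δ * ‖u₀‖ + 1 / 2 * Real.exp (B' / 2) * ‖u₀ - u₀'‖) :=
        hfin.trans (by gcongr; exact hgrad.trans hinit)
    _ = Real.exp (B' / 2) * δ * (‖u t‖ + ‖u₀‖) +
        Real.exp (B' / 2) * Real.exp (B' / 2) * ‖u₀ - u₀'‖ := by ring
    _ = _ := by rw [← Real.exp_add, add_halves]

end MetricGraph

theorem corollaryC {V E : Type*} [Finite E] (Γ : MetricGraph V E)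
    (hconn : Γ.Connected) (hloop : Γ.NoLoops) (hmult : Γ.NoMultipleEdges)
    (c : E → ℝ) (hc : ∀ e, 0 < c e) :
    ∃ c₁ c₂ c₃ c₄ : ℝ, 0 < c₁ ∧ 0 < c₂ ∧ 0 < c₃ ∧ 0 < c₄ ∧
      ∀ (s₀ : Γ.Space) (h₀ : Γ.Space → ℝ) (u₀ : Γ.L2 c) (u : ℝ → Γ.L2 c),
        Γ.HasGrad c h₀ u₀ → h₀ s₀ = 0 → Γ.IsColeHopfSolution c h₀ u →
        (∀ t, 0 < t → ‖u t‖ ≤ c₁ * ‖u₀‖ * Real.exp (c₂ * ‖u₀‖)) ∧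
        ∀ (h₀' : Γ.Space → ℝ) (u₀' : Γ.L2 c) (u' : ℝ → Γ.L2 c),
          Γ.HasGrad c h₀' u₀' → h₀' s₀ = 0 → Γ.IsColeHopfSolution c h₀' u' →
          ∀ t, 0 < t →
            ‖u t - u' t‖ ≤
              c₃ * (‖u₀‖ + 1) ^ 2 * Real.exp (c₄ * (‖u₀‖ + ‖u₀'‖)) * ‖u₀ - u₀'‖ := by
  obtain ⟨C, hC, hosc⟩ := MetricGraph.exists_osc_bound hc hconn
  -- Every exponential below is at most `X = e^{C(‖u₀‖ + ‖u₀'‖)}`. The first term of the difference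
  -- estimate contains three of them, hence `3 * C`; in `C + 1` the `C` is the oscillation constant
  -- bounding `h₀ - h₀'` and the `1` is for the second term.
  refine ⟨1, C, C + 1, 3 * C, one_pos, hC, by positivity, by positivity,
    fun s₀ h₀ u₀ u hu₀ hs₀ hu => ?_⟩
  have hB : ∀ x, |h₀ x| ≤ C * ‖u₀‖ := fun x => by simpa [hs₀] using hosc h₀ u₀ hu₀ x s₀
  have hi : ∀ t, 0 < t → ‖u t‖ ≤ ‖u₀‖ * Real.exp (C * ‖u₀‖) := fun t ht =>
    MetricGraph.norm_coleHopf_le hc hconn hB hu₀ hu ht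
  refine ⟨fun t ht => by simpa using hi t ht, fun h₀' u₀' u' hu₀' hs₀' hu' t ht => ?_⟩
  have hB' : ∀ x, |h₀' x| ≤ C * ‖u₀'‖ := fun x => by simpa [hs₀'] using hosc h₀' u₀' hu₀' x s₀
  have hD : ∀ x, |h₀ x - h₀' x| ≤ C * ‖u₀ - u₀'‖ := fun x => by
    simpa [hs₀, hs₀'] using hosc _ _ (hu₀.sub hc hu₀') x s₀
  have hmain := MetricGraph.norm_coleHopf_sub_le hc hconn hB hB'
    (by positivity) hD hu₀ hu hu₀' hu' ht
  have hut := hi t ht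
  set a := ‖u₀‖
  set a' := ‖u₀'‖
  set d := ‖u₀ - u₀'‖
  have ha : 0 ≤ a := norm_nonneg _
  have ha' : 0 ≤ a' := norm_nonneg _
  have hd : 0 ≤ d := norm_nonneg _
  have hCa : 0 ≤ C * a := by positivity
  have hCa' : 0 ≤ C * a' := by positivity
  set X := Real.exp (C * (a + a')) with hX
  have hX1 : 1 ≤ X := Real.one_le_exp (by positivity)
  have e1 : Real.exp (C * a' / 2) ≤ X := Real.exp_le_exp.2 (by linarith)
  have e2 : Real.exp ((C * a + C * a') / 2) ≤ X := Real.exp_le_exp.2 (by linarith)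
  have e3 : Real.exp (C * a) ≤ X := Real.exp_le_exp.2 (by linarith)
  have e4 : Real.exp (C * a') ≤ X := Real.exp_le_exp.2 (by linarith)
  have hX3 : Real.exp (3 * C * (a + a')) = X ^ 3 := by
    rw [hX, ← Real.exp_nat_mul]
    congr 1
    push_cast
    ring
  have hXX : X ≤ X ^ 3 := le_self_pow₀ hX1 three_ne_zero
  have hsum : ‖u t‖ + a ≤ 2 * a * X := by
    have h1 := hut.trans (mul_le_mul_of_nonneg_left e3 ha)
    have h2 := mul_le_mul_of_nonneg_left hX1 ha
    linarith
  rw [hX3]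
  calc ‖u t - u' t‖ ≤ X * (1 / 2 * X * (C * d)) * (2 * a * X) + X * d :=
        hmain.trans (by gcongr)
    _ = C * a * X ^ 3 * d + X * d := by ring
    -- The bound obtained is only linear in `‖u₀‖`; the square is slack.
    _ ≤ C * (a + 1) ^ 2 * X ^ 3 * d + (a + 1) ^ 2 * X ^ 3 * d := by
      have h1 : a ≤ (a + 1) ^ 2 := by nlinarith
      have h2 : X ≤ (a + 1) ^ 2 * X ^ 3 :=
        hXX.trans (le_mul_of_one_le_left (by positivity) (by nlinarith))
      gcongr
    _ = _ := by ring
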